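/- Let $\kappa\le\lambda$ be infinite regular cardinals with $\kappa\vartriangleleft\lambda$, i.e. for every set $X$ with $|X|<\lambda$ the poset of subsets of $X$ of cardinality $<\kappa$, ordered by inclusion, has a cofinal subset of cardinality $<\lambda$. For a regular cardinal $\mu$, a $<\mu$-limit is a limit of a diagram indexed by a category with fewer than $\mu$ arrows; a category is $\mu$-lex if it has all $<\mu$-limits, and a functor is $\mu$-lex if it preserves all $<\mu$-limits; $\mathbf{Lex}_\mu(\mathcal{A},\mathcal{B})$ denotes the category of $\mu$-lex functors $\mathcal{A}\to\mathcal{B}$ and all natural transformations. Let $\mathcal{C}$ be a small $\kappa$-lex category and let $y:\mathcal{C}\hookrightarrow\mathbf{Lex}_\kappa(\mathcal{C},\mathbf{Set})^{op}$, $y(c)=\mathcal{C}(c,-)$. Let $\widetilde{\mathcal{C}}$ be the full subcategory of $\mathbf{Lex}_\kappa(\mathcal{C},\mathbf{Set})^{op}$ on the objects that are limits (in $\mathbf{Lex}_\kappa(\mathcal{C},\mathbf{Set})^{op}$) of diagrams of representables indexed by a $\kappa$-cofiltered category with fewer than $\lambda$ arrows, and let $\varphi:\mathcal{C}\hookrightarrow\widetilde{\mathcal{C}}$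 be the functor through which $y$ factors. Then: 1. $\widetilde{\mathcal{C}}$ is $\lambda$-lex; 2. $\varphi$ is $\kappa$-lex; 3. for every (locally small) category $\mathcal{E}$ with all small limits, precomposition with $\varphi$ is an equivalence $\varphi^*:\mathbf{Lex}_\lambda(\widetilde{\mathcal{C}},\mathcal{E})\to\mathbf{Lex}_\kappa(\mathcal{C},\mathcal{E})$. -/

import Mathlib

open CategoryTheory CategoryTheory.Limits Opposite

universe w v u v₁ u₁ v₂ u₂ v₃ u₃

/-- `κ` is sharply smaller than `μ` (written `κ ⊲ μ`): `κ ≤ μ`, and for every set `X` of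
cardinality `< μ` the poset of subsets of `X` of cardinality `< κ`, ordered by inclusion, has a
cofinal set of cardinality `< μ`. It is used for regular cardinals only. -/
structure SharplySmaller (κ μ : Cardinal.{w}) : Prop where
  le : κ ≤ μ
  exists_cofinal : ∀ X : Type w, HasCardinalLT X μ →
    ∃ S : Set (Set X), HasCardinalLT S μ ∧ (∀ A ∈ S, HasCardinalLT A κ) ∧
      ∀ B : Set X, HasCardinalLT B κ → ∃ A ∈ S, B ⊆ A

/-- A category is `κ`-lex if it has all `<κ`-limits, i.e. limits of diagrams indexed by
categories with fewer than `κ` arrows. -/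
def IsLexCategory (κ : Cardinal.{w}) (C : Type u₁) [Category.{v₁} C] : Prop :=
  ∀ (J : Type w) [SmallCategory J], HasCardinalLT (Arrow J) κ → HasLimitsOfShape J C

/-- A functor is `κ`-lex if it preserves all `<κ`-limits. -/
def isLexFunctor (κ : Cardinal.{w}) (C : Type u₁) [Category.{v₁} C]
    (D : Type u₂) [Category.{v₂} D] : ObjectProperty (C ⥤ D) :=
  fun F => ∀ (J : Type w) [SmallCategory J], HasCardinalLT (Arrow J) κ →
    PreservesLimitsOfShape J F

/-- The category `Lex_κ(C, D)` of `κ`-lex functors and all natural transformations. -/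
abbrev LexFunctors (κ : Cardinal.{w}) (C : Type u₁) [Category.{v₁} C]
    (D : Type u₂) [Category.{v₂} D] : Type (max u₁ v₁ u₂ v₂) :=
  (isLexFunctor κ C D).FullSubcategory

/-- If `φ : C ⥤ D` is `κ`-lex and `κ ≤ μ`, then precomposition with `φ` is a functor
`φ* : Lex_μ(D, E) ⥤ Lex_κ(C, E)`. -/
def lexPrecomp {κ μ : Cardinal.{w}} (h : κ ≤ μ)
    {C : Type u₁} [Category.{v₁} C] {D : Type u₂} [Category.{v₂} D]
    (φ : C ⥤ D) (hφ : isLexFunctor κ C D φ) (E : Type u₃) [Category.{v₃} E] :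
    LexFunctors μ D E ⥤ LexFunctors κ C E :=
  (isLexFunctor κ C E).lift
    ((isLexFunctor μ D E).ι ⋙ (Functor.whiskeringLeft C D E).obj φ)
    (fun F J _ hJ => by
      have h₁ := hφ J hJ
      have h₂ := F.property J (hJ.of_le h)
      exact comp_preservesLimitsOfShape φ F.obj)

section

variable (κ : Cardinal.{w}) (C : Type w) [SmallCategory C]

/-- The embedding `y : C ⥤ Lex_κ(C, Set)ᵒᵖ`, `c ↦ C(c, -)`. -/
def lexYoneda : C ⥤ (LexFunctors κ C (Type w))ᵒᵖ :=
  ((isLexFunctor κ C (Type w)).lift coyoneda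
    (fun _ _ _ _ => inferInstanceAs (PreservesLimitsOfShape _ (coyoneda.obj _)))).rightOp

variable [Fact κ.IsRegular] (μ : Cardinal.{w})

/-- The objects of `Lex_κ(C, Set)ᵒᵖ` that are limits, taken in `Lex_κ(C, Set)ᵒᵖ`, of diagrams of
representables indexed by a `κ`-cofiltered category with fewer than `μ` arrows. -/
def isCofilteredLimitOfRepresentables : ObjectProperty (LexFunctors κ C (Type w))ᵒᵖ :=
  fun X => ∃ (J : Type w) (_ : SmallCategory J),
    IsCardinalFiltered Jᵒᵖ κ ∧ HasCardinalLT (Arrow J) μ ∧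
      (lexYoneda κ C).essImage.limitsOfShape J X

/-- The category `C̃`: the full subcategory of `Lex_κ(C, Set)ᵒᵖ` on the `κ`-cofiltered
`<μ`-limits of representables. -/
abbrev LexCompletion : Type (w + 1) :=
  (isCofilteredLimitOfRepresentables κ C μ).FullSubcategory

variable [Fact μ.IsRegular]

theorem isCofilteredLimitOfRepresentables_lexYoneda (c : C) :
    isCofilteredLimitOfRepresentables κ C μ ((lexYoneda κ C).obj c) := by
  have hμ : Cardinal.aleph0 ≤ μ := (Fact.out : μ.IsRegular).aleph0_le
  refine ⟨Discrete PUnit, inferInstance, ?_, ?_, ?_⟩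
  · exact IsTerminal.isCardinalFiltered (X := op ⟨PUnit.unit⟩)
      (IsTerminal.ofUniqueHom (fun _ => (Discrete.eqToHom (by rfl)).op)
        (fun _ _ => Subsingleton.elim _ _)) κ
  · rw [hasCardinalLT_arrow_discrete_iff]
    exact hasCardinalLT_of_finite _ _ hμ
  · refine ⟨{ diag := (Functor.const _).obj ((lexYoneda κ C).obj c)
              π := 𝟙 _
              isLimit := ?_
              prop_diag_obj := fun _ => (lexYoneda κ C).obj_mem_essImage c }⟩
    exact { lift := fun s => s.π.app ⟨PUnit.unit⟩
            fac := fun s j => by simp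
            uniq := fun s m hm => by simpa using hm ⟨PUnit.unit⟩ }

/-- The functor `φ : C ⥤ C̃` through which `y` factors. -/
def lexCompletionEmbedding : C ⥤ LexCompletion κ C μ :=
  (isCofilteredLimitOfRepresentables κ C μ).lift (lexYoneda κ C)
    (isCofilteredLimitOfRepresentables_lexYoneda κ C μ)

end

/-! ### Multiequalizers and their restrictions to small sets of vertices. -/

namespace CategoryTheory.Limits

/-! All that is used of `y : C ⥤ D = Lex_κ(C, Set)ᵒᵖ` is recorded in `IsCopresentableEmbedding`,
plus the fact that the functors `E(e, G -)` with `G` κ-lex are of the form `D(Z, y -)`.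

Limits: a `<μ`-diagram of objects of `C̃`, each presented as a cofiltered limit of representables,
unfolds by copresentability into a `<μ`-multiequalizer of representables (`exists_isLimit`). Such a
multiequalizer is the limit of the multiequalizers, taken in `C`, of its `<κ`-pieces; `κ ⊲ μ`
supplies a κ-directed family of fewer than `μ` pieces (`exists_multiequalizer`). So `C̃` is closed
in `D` under `<μ`-limits.

Universal property: a μ-lex functor on `C̃` is the pointwise right Kan extension of its restriction
along `φ`, which gives full faithfulness. Conversely, the extension of a κ-lex `G` is μ-lex: after
applying `E(e, -)` it becomes the restriction to `C̃` of some `D(Z, -)`. -/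

lemma hasCardinalLT_arrow_walkingMulticospan {κ : Cardinal.{w}} (hκ : Cardinal.aleph0 ≤ κ)
    (S : MulticospanShape.{w, w}) (hL : HasCardinalLT S.L κ) (hR : HasCardinalLT S.R κ) :
    HasCardinalLT (Arrow (WalkingMulticospan S)) κ := by
  have h : HasCardinalLT (S.L ⊕ S.R ⊕ S.R ⊕ S.R) κ := by
    simp only [hasCardinalLT_sum_iff _ _ _ hκ]
    exact ⟨hL, hR, hR, hR⟩
  refine h.of_surjective (Sum.elim (fun l ↦ Arrow.mk (𝟙 (WalkingMulticospan.left l)))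
    (Sum.elim (fun r ↦ Arrow.mk (𝟙 (WalkingMulticospan.right r)))
      (Sum.elim (fun r ↦ Arrow.mk (Y := WalkingMulticospan.right r)
          (WalkingMulticospan.Hom.fst r))
        (fun r ↦ Arrow.mk (Y := WalkingMulticospan.right r)
          (WalkingMulticospan.Hom.snd r))))) ?_
  rintro ⟨x, y, f⟩
  dsimp at x y f
  obtain (_ | r | r) := f
  · obtain (l | r) := x
    · exact ⟨Sum.inl l, rfl⟩
    · exact ⟨Sum.inr (Sum.inl r), rfl⟩
  · exact ⟨Sum.inr (Sum.inr (Sum.inl r)), rfl⟩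
  · exact ⟨Sum.inr (Sum.inr (Sum.inr r)), rfl⟩

lemma Multifork.existsUnique_lift_of_preservesLimit {S : MulticospanShape.{w, w}}
    {C : Type u₁} [Category.{v₁} C] {D : Type u₂} [Category.{v₂} D] {I : MulticospanIndex S C}
    {c : Multifork I} (hc : IsLimit c) (F : C ⥤ D) [PreservesLimit I.multicospan F]
    {Z : D} (q : ∀ l, Z ⟶ F.obj (I.left l))
    (hq : ∀ r, q (S.fst r) ≫ F.map (I.fst r) = q (S.snd r) ≫ F.map (I.snd r)) :
    ∃! f : Z ⟶ F.obj c.pt, ∀ l, f ≫ F.map (c.ι l) = q l := by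
  let s : Cone (I.multicospan ⋙ F) :=
    { pt := Z
      π :=
        { app := fun x ↦ match x with
            | .left l => q l
            | .right r => by exact q (S.fst r) ≫ F.map (I.fst r)
          naturality := by
            rintro _ _ (⟨l | r⟩ | r | r)
            · simp
            · simp
            · exact Category.id_comp _
            · exact (Category.id_comp _).trans (hq r) } }
  have h := isLimitOfPreserves F hc
  refine ⟨h.lift s, fun l ↦ h.fac s (.left l), fun f hf ↦ h.hom_ext ?_⟩
  rintro (l | r)
  · exact (hf l).trans (h.fac s (.left l)).symm
  · rw [h.fac s (.right r)]
    change f ≫ F.map (c.π.app (.right r)) = q (S.fst r) ≫ F.map (I.fst r)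
    rw [Multifork.app_right_eq_ι_comp_fst]
    exact (congr_arg (f ≫ ·) (F.map_comp (c.ι (S.fst r)) (I.fst r))).trans
      ((Category.assoc _ _ _).symm.trans (congr_arg (· ≫ F.map (I.fst r)) (hf _)))

/-- The part of a multiequalizer shape spanned by a set of vertices: the left vertices are
those in the set and those which are adjacent to a right vertex in the set. -/
abbrev MulticospanShape.restrict (S : MulticospanShape.{w, w}) (A : Set (S.L ⊕ S.R)) :
    MulticospanShape.{w, w} where
  L := {l : S.L // Sum.inl l ∈ A ∨ ∃ r, Sum.inr r ∈ A ∧ (S.fst r = l ∨ S.snd r = l)}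
  R := {r : S.R // Sum.inr r ∈ A}
  fst r := ⟨S.fst r.1, Or.inr ⟨r.1, r.2, Or.inl rfl⟩⟩
  snd r := ⟨S.snd r.1, Or.inr ⟨r.1, r.2, Or.inr rfl⟩⟩

lemma MulticospanShape.hasCardinalLT_restrict_R {κ : Cardinal.{w}}
    (S : MulticospanShape.{w, w}) {A : Set (S.L ⊕ S.R)} (hA : HasCardinalLT A κ) :
    HasCardinalLT (S.restrict A).R κ :=
  hA.of_injective (fun r ↦ ⟨Sum.inr r.1, r.2⟩) (fun _ _ h ↦
    Subtype.ext (Sum.inr_injective (congr_arg Subtype.val h)))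

lemma MulticospanShape.hasCardinalLT_restrict_L {κ : Cardinal.{w}} (hκ : Cardinal.aleph0 ≤ κ)
    (S : MulticospanShape.{w, w}) {A : Set (S.L ⊕ S.R)} (hA : HasCardinalLT A κ) :
    HasCardinalLT (S.restrict A).L κ := by
  have h₁ : HasCardinalLT {l : S.L // Sum.inl l ∈ A} κ :=
    hA.of_injective (fun l ↦ ⟨Sum.inl l.1, l.2⟩) (fun _ _ h ↦
      Subtype.ext (Sum.inl_injective (congr_arg Subtype.val h)))
  have h₂ := S.hasCardinalLT_restrict_R hA
  have h : HasCardinalLT ({l : S.L // Sum.inl l ∈ A} ⊕ (S.restrict A).R ⊕ (S.restrict A).R) κ := by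
    simp only [hasCardinalLT_sum_iff _ _ _ hκ]
    exact ⟨h₁, h₂, h₂⟩
  refine h.of_surjective (Sum.elim (fun l ↦ ⟨l.1, Or.inl l.2⟩)
    (Sum.elim (S.restrict A).fst (S.restrict A).snd)) ?_
  rintro ⟨l, hl | ⟨r, hr, rfl | rfl⟩⟩
  · exact ⟨Sum.inl ⟨l, hl⟩, rfl⟩
  · exact ⟨Sum.inr (Sum.inl ⟨r, hr⟩), rfl⟩
  · exact ⟨Sum.inr (Sum.inr ⟨r, hr⟩), rfl⟩

namespace MulticospanIndex

variable {S : MulticospanShape.{w, w}} {C : Type u₁} [Category.{v₁} C] (I : MulticospanIndex S C)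

/-- The restriction of a multiequalizer diagram to the part of its shape spanned by
a set of vertices. -/
abbrev restrict (A : Set (S.L ⊕ S.R)) : MulticospanIndex (S.restrict A) C where
  left l := I.left l.1
  right r := I.right r.1
  fst r := I.fst r.1
  snd r := I.snd r.1

/-- The multiequalizers of the restrictions of a diagram to the sets of vertices in a family. -/
@[simps]
noncomputable def restrictFunctor (T : Set (Set (S.L ⊕ S.R)))
    [∀ A : T, HasMultiequalizer (I.restrict A.1)] : Tᵒᵖ ⥤ C where
  obj A := multiequalizer (I.restrict A.unop.1)
  map {A B} h := Multiequalizer.lift _ _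
    (fun l ↦ Multiequalizer.ι (I.restrict A.unop.1)
      ⟨l.1, l.2.imp (fun hl ↦ leOfHom h.unop hl)
        (fun ⟨r, hr, hr'⟩ ↦ ⟨r, leOfHom h.unop hr, hr'⟩)⟩)
    (fun r ↦ Multiequalizer.condition (I.restrict A.unop.1) ⟨r.1, leOfHom h.unop r.2⟩)
  map_id A := Multiequalizer.hom_ext _ _ _ (fun l ↦ by
    rw [Multiequalizer.lift_ι, Category.id_comp])
  map_comp f g := Multiequalizer.hom_ext _ _ _ (fun l ↦ by
    simp only [Multiequalizer.lift_ι, Category.assoc])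

end MulticospanIndex

end CategoryTheory.Limits

/-! ### Copresentable embeddings; `<μ`-multiequalizers of objects of `C`. -/

section

/-- By regularity a union of fewer than `κ` sets of size `<κ` again has size `<κ`, so a cofinal
family of such sets is κ-directed; cofinality over singletons makes it cover `X`. -/
lemma SharplySmaller.exists_directed {κ μ : Cardinal.{w}} [Fact κ.IsRegular]
    (h : SharplySmaller κ μ) {X : Type w} (hX : HasCardinalLT X μ) :
    ∃ T : Set (Set X), HasCardinalLT T μ ∧ IsCardinalFiltered T κ ∧
      (∀ A ∈ T, HasCardinalLT A κ) ∧ ∀ x, ∃ A ∈ T, x ∈ A := by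
  obtain ⟨T, hT, hTκ, hT'⟩ := h.exists_cofinal X hX
  refine ⟨T, hT, isCardinalFiltered_preorder _ _ (fun K s hK ↦ ?_), hTκ, fun x ↦ ?_⟩
  · obtain ⟨A, hA, hA'⟩ := hT' (⋃ k, (s k).1) (hasCardinalLT_iUnion _
      (by rwa [hasCardinalLT_iff_cardinal_mk_lt]) (fun k ↦ hTκ _ (s k).2))
    exact ⟨⟨A, hA⟩, fun k ↦ (Set.subset_iUnion (fun k ↦ (s k).1) k).trans hA'⟩
  · obtain ⟨A, hA, hA'⟩ := hT' {x} (hasCardinalLT_of_finite _ _ (Fact.out : κ.IsRegular).aleph0_le)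
    exact ⟨A, hA, hA' rfl⟩

/-- A functor `y : C ⥤ D` is a `κ`-copresentable embedding if it is fully faithful, preserves
`<κ`-limits, and identifies `C` with a category of `κ`-copresentable objects in a category which
has `κ`-cofiltered limits. -/
structure IsCopresentableEmbedding (κ : Cardinal.{w}) [Fact κ.IsRegular]
    {C : Type u₁} [Category.{v₁} C] {D : Type u₂} [Category.{v₂} D] (y : C ⥤ D) : Prop where
  full : y.Full
  faithful : y.Faithful
  isLex : isLexFunctor κ C D y
  hasLimitsOfShape (J : Type w) [SmallCategory J] (hJ : IsCardinalFiltered Jᵒᵖ κ) :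
    HasLimitsOfShape J D
  preservesColimitsOfShape (c : C) (J : Type w) [SmallCategory J] (hJ : IsCardinalFiltered Jᵒᵖ κ) :
    PreservesColimitsOfShape Jᵒᵖ (yoneda.obj (y.obj c))

/-- The objects of `D` that are limits of diagrams of objects in the essential image of `y`,
indexed by a `κ`-cofiltered category with fewer than `μ` arrows. -/
def isCofilteredLimitOfEssImage (κ μ : Cardinal.{w}) [Fact κ.IsRegular]
    {C : Type u₁} [Category.{v₁} C] {D : Type u₂} [Category.{v₂} D] (y : C ⥤ D) :
    ObjectProperty D :=
  fun X ↦ ∃ (J : Type w) (_ : SmallCategory J),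
    IsCardinalFiltered Jᵒᵖ κ ∧ HasCardinalLT (Arrow J) μ ∧ y.essImage.limitsOfShape J X

variable {κ μ : Cardinal.{w}} [Fact κ.IsRegular]
  {C : Type u₁} [Category.{v₁} C] {D : Type u₂} [Category.{v₂} D] {y : C ⥤ D}

lemma isCofilteredLimitOfEssImage.exists_presentation [y.Full] [y.Faithful]
    {X : D} (hX : isCofilteredLimitOfEssImage κ μ y X) :
    ∃ (J : Type w) (_ : SmallCategory J) (_ : IsCardinalFiltered Jᵒᵖ κ)
      (_ : HasCardinalLT (Arrow J) μ) (G : J ⥤ C) (π : (Functor.const J).obj X ⟶ G ⋙ y),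
      Nonempty (IsLimit (Cone.mk X π)) := by
  obtain ⟨J, _, hJ, hJ', ⟨p⟩⟩ := hX
  let G : J ⥤ C :=
    { obj j := (p.prop_diag_obj j).witness
      map {i j} f := y.preimage ((p.prop_diag_obj i).getIso.hom ≫ p.diag.map f ≫
        (p.prop_diag_obj j).getIso.inv)
      map_id j := y.map_injective (by simp)
      map_comp f g := y.map_injective (by simp) }
  let e : p.diag ≅ G ⋙ y := NatIso.ofComponents (fun j ↦ (p.prop_diag_obj j).getIso.symm)
  exact ⟨J, inferInstance, hJ, hJ', G, p.π ≫ e.hom,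
    ⟨(IsLimit.postcomposeHomEquiv e _).symm p.isLimit⟩⟩

lemma isCofilteredLimitOfEssImage.mk {J : Type w} [SmallCategory J]
    (hJ : IsCardinalFiltered Jᵒᵖ κ) (hJ' : HasCardinalLT (Arrow J) μ) {G : J ⥤ C}
    {c : Cone (G ⋙ y)} (hc : IsLimit c) : isCofilteredLimitOfEssImage κ μ y c.pt :=
  ⟨J, inferInstance, hJ, hJ', ⟨{
    diag := _
    π := c.π
    isLimit := hc
    prop_diag_obj _ := y.obj_mem_essImage _ }⟩⟩

variable [Fact μ.IsRegular]

/-- `X` is the limit in `D` of the multiequalizers, formed in `C` and preserved by `y`, of the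
restrictions of `I` to the members of a κ-directed cover of the vertices. Compatible families on all
pieces amount to one family on the whole diagram. -/
lemma IsCopresentableEmbedding.exists_multiequalizer (hκμ : SharplySmaller κ μ)
    (hC : IsLexCategory κ C) (hy : IsCopresentableEmbedding κ y)
    {S : MulticospanShape.{w, w}} (I : MulticospanIndex S C)
    (hL : HasCardinalLT S.L μ) (hR : HasCardinalLT S.R μ) :
    ∃ (X : D) (p : ∀ l, X ⟶ y.obj (I.left l)), isCofilteredLimitOfEssImage κ μ y X ∧
      (∀ r, p (S.fst r) ≫ y.map (I.fst r) = p (S.snd r) ≫ y.map (I.snd r)) ∧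
      ∀ ⦃Z : D⦄ (q : ∀ l, Z ⟶ y.obj (I.left l)),
        (∀ r, q (S.fst r) ≫ y.map (I.fst r) = q (S.snd r) ≫ y.map (I.snd r)) →
          ∃! f : Z ⟶ X, ∀ l, f ≫ p l = q l := by
  have hκ : Cardinal.aleph0 ≤ κ := (Fact.out : κ.IsRegular).aleph0_le
  have hμ : Cardinal.aleph0 ≤ μ := (Fact.out : μ.IsRegular).aleph0_le
  obtain ⟨T, hT, hT', hTκ, hTx⟩ := hκμ.exists_directed (X := S.L ⊕ S.R)
    (by rw [hasCardinalLT_sum_iff _ _ _ hμ]; exact ⟨hL, hR⟩)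
  have hA (A : T) : HasCardinalLT (Arrow (WalkingMulticospan (S.restrict A.1))) κ :=
    hasCardinalLT_arrow_walkingMulticospan hκ _
      (S.hasCardinalLT_restrict_L hκ (hTκ _ A.2)) (S.hasCardinalLT_restrict_R (hTκ _ A.2))
  have (A : T) := hC _ (hA A)
  have (A : T) := hy.isLex _ (hA A)
  have hTop : IsCardinalFiltered Tᵒᵖᵒᵖ κ := .of_equivalence κ (opOpEquivalence T).symm
  have := hy.hasLimitsOfShape Tᵒᵖ hTop
  have hArr : HasCardinalLT (Arrow Tᵒᵖ) μ := by
    rw [hasCardinalLT_arrow_op_iff]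
    refine (hasCardinalLT_prod hμ hT hT).of_injective (fun f ↦ (f.left, f.right)) ?_
    rintro ⟨a, b, f⟩ ⟨a', b', f'⟩ h
    obtain ⟨rfl, rfl⟩ := Prod.ext_iff.1 h
    obtain rfl : f = f' := Subsingleton.elim _ _
    rfl
  let M := I.restrictFunctor T
  let X := limit (M ⋙ y)
  let ρ (A : T) : X ⟶ y.obj (M.obj (op A)) := limit.π (M ⋙ y) (op A)
  let P (A : T) (l : S.L) : Prop :=
    Sum.inl l ∈ A.1 ∨ ∃ r, Sum.inr r ∈ A.1 ∧ (S.fst r = l ∨ S.snd r = l)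
  have hP {A B : T} (h : A ≤ B) {l : S.L} (hl : P A l) : P B l :=
    hl.imp (@h _) (fun ⟨r, hr, hr'⟩ ↦ ⟨r, h hr, hr'⟩)
  let ι (A : T) (l : S.L) (hl : P A l) : M.obj (op A) ⟶ I.left l :=
    Multiequalizer.ι (I.restrict A.1) ⟨l, hl⟩
  have hM {A B : T} (h : A ≤ B) (l : S.L) (hl : P A l) :
      M.map (homOfLE h).op ≫ ι A l hl = ι B l (hP h hl) :=
    Multiequalizer.lift_ι (I.restrict A.1) _ _ _ _
  have hι {A B : T} (h : A ≤ B) (l : S.L) (hl : P A l) :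
      ρ A ≫ y.map (ι A l hl) = ρ B ≫ y.map (ι B l (hP h hl)) := by
    have h₁ : ρ A = ρ B ≫ y.map (M.map (homOfLE h).op) := (limit.w (M ⋙ y) (homOfLE h).op).symm
    rw [h₁, Category.assoc, ← y.map_comp, hM]
  -- The projection to `l` is read off at a chosen piece containing `l`; directedness makes it
  -- independent of the choice (`hp`).
  choose a ha ha' using fun l ↦ hTx (Sum.inl l)
  let p (l : S.L) : X ⟶ y.obj (I.left l) := ρ ⟨a l, ha l⟩ ≫ y.map (ι ⟨a l, ha l⟩ l (Or.inl (ha' l)))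
  have : IsFiltered T := isFiltered_of_isCardinalFiltered _ κ
  have : IsDirectedOrder T := IsFiltered.isDirectedOrder _
  have hp (A : T) (l : S.L) (hl : P A l) : ρ A ≫ y.map (ι A l hl) = p l := by
    obtain ⟨B, hAB, hB⟩ := exists_ge_ge A (⟨a l, ha l⟩ : T)
    exact (hι hAB l hl).trans (hι hB l (Or.inl (ha' l))).symm
  have hlift {Z : D} (q : ∀ l, Z ⟶ y.obj (I.left l))
      (hq : ∀ r, q (S.fst r) ≫ y.map (I.fst r) = q (S.snd r) ≫ y.map (I.snd r)) (A : T) :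
      ∃! f : Z ⟶ y.obj (M.obj (op A)), ∀ l hl, f ≫ y.map (ι A l hl) = q l := by
    simpa using! Multifork.existsUnique_lift_of_preservesLimit
      (limit.isLimit (I.restrict A.1).multicospan) y (fun l ↦ q l.1) (fun r ↦ hq r.1)
  refine ⟨X, p, .mk hTop hArr (limit.isLimit (M ⋙ y)), fun r ↦ ?_, fun Z q hq ↦ ?_⟩
  · obtain ⟨A, hA, hA'⟩ := hTx (Sum.inr r)
    rw [← hp ⟨A, hA⟩ (S.fst r) (Or.inr ⟨r, hA', Or.inl rfl⟩),
      ← hp ⟨A, hA⟩ (S.snd r) (Or.inr ⟨r, hA', Or.inr rfl⟩),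
      Category.assoc, Category.assoc, ← y.map_comp, ← y.map_comp]
    congr 2
    exact Multiequalizer.condition (I.restrict (⟨A, hA⟩ : T).1) ⟨r, hA'⟩
  · choose f hf hf' using fun A : T ↦ hlift q hq A
    dsimp only at hf
    let s : Cone (M ⋙ y) :=
      { pt := Z
        π :=
          { app A := f A.unop
            naturality A B h := by
              refine (Category.id_comp _).trans (hf' B.unop _ (fun l hl ↦ ?_)).symm
              have h' : B.unop ≤ A.unop := leOfHom h.unop
              rw [← hf A.unop l (hP h' hl), ← hM h' l hl, y.map_comp]
              exact Category.assoc _ _ _ } }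
    have hs (A : T) : limit.lift (M ⋙ y) s ≫ ρ A = f A := limit.lift_π s (op A)
    refine ⟨limit.lift _ s, fun l ↦ ?_, fun g hg ↦ limit.hom_ext (fun A ↦ ?_)⟩
    · rw [← Category.assoc, hs, hf]
    · refine Eq.trans (hf' A.unop _ (fun l hl ↦ ?_)) (hs A.unop).symm
      exact (Category.assoc _ _ _).trans ((congr_arg (g ≫ ·) (hp A.unop l hl)).trans (hg l))

end

/-! ### `<μ`-limits in `C̃`. -/

section

variable {κ μ : Cardinal.{w}} [Fact κ.IsRegular] [Fact μ.IsRegular]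
  {C : Type u₁} [Category.{v₁} C] {D : Type u₂} [Category.{v₂} D] {y : C ⥤ D}

/-- A cone over `F` is a family of maps to all the objects `y (G k j)`, compatible with the arrows
of each `J k` and with those of `K`. Both kinds of compatibility are equations between maps of `C`,
so the limit is a multiequalizer. -/
lemma IsCopresentableEmbedding.exists_isLimit (hκμ : SharplySmaller κ μ)
    (hC : IsLexCategory κ C) (hy : IsCopresentableEmbedding κ y)
    {K : Type w} [SmallCategory K] (hK : HasCardinalLT (Arrow K) μ) (F : K ⥤ D)
    (hF : ∀ k, isCofilteredLimitOfEssImage κ μ y (F.obj k)) :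
    ∃ c : Cone F, Nonempty (IsLimit c) ∧ isCofilteredLimitOfEssImage κ μ y c.pt := by
  have := hy.full
  have := hy.faithful
  have hμ : Cardinal.aleph0 ≤ μ := (Fact.out : μ.IsRegular).aleph0_le
  choose J _ hJ hJ' G π hπ using fun k ↦ (hF k).exists_presentation
  replace hπ (k : K) : IsLimit (Cone.mk (F.obj k) (π k)) := (hπ k).some
  let ρ (k : K) (j : J k) : F.obj k ⟶ y.obj ((G k).obj j) := (π k).app j
  have hρ (k : K) {i j : J k} (f : i ⟶ j) : ρ k i ≫ y.map ((G k).map f) = ρ k j :=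
    (Cone.mk (F.obj k) (π k)).w f
  -- Copresentability of `y (G j)` factors this composite through one stage of the presentation of
  -- the source. The choices need not be coherent: each one encodes the condition for `u` and `j`
  -- exactly.
  have hu (u : Arrow K) (j : J u.right) : ∃ (j' : J u.left)
      (g : (G u.left).obj j' ⟶ (G u.right).obj j),
        ρ u.left j' ≫ y.map g = F.map u.hom ≫ ρ u.right j := by
    have := hy.preservesColimitsOfShape ((G u.right).obj j) (J u.left) (hJ _)
    obtain ⟨j', g, hg⟩ := exists_hom_of_preservesColimit_yoneda (hπ u.left)
      (X := y.obj ((G u.right).obj j)) (F.map u.hom ≫ ρ u.right j)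
    obtain ⟨g, rfl⟩ := y.map_surjective g
    exact ⟨j', g, hg⟩
  choose j' g hg using hu
  let S : MulticospanShape.{w, w} :=
    { L := Σ k, J k
      R := (Σ k, Arrow (J k)) ⊕ (Σ u : Arrow K, J u.right)
      fst := Sum.elim (fun x ↦ ⟨x.1, x.2.left⟩) (fun x ↦ ⟨x.1.left, j' x.1 x.2⟩)
      snd := Sum.elim (fun x ↦ ⟨x.1, x.2.right⟩) (fun x ↦ ⟨x.1.right, x.2⟩) }
  let I : MulticospanIndex S C :=
    { left l := (G l.1).obj l.2
      right := Sum.elim (fun x ↦ (G x.1).obj x.2.right) (fun x ↦ (G x.1.right).obj x.2)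
      fst := by rintro (x | x); exacts [(G x.1).map x.2.hom, g x.1 x.2]
      snd := by rintro (x | x); exacts [𝟙 _, 𝟙 _] }
  have hL : HasCardinalLT S.L μ := hasCardinalLT_sigma _ _
    (hasCardinalLT_of_hasCardinalLT_arrow hK) (fun k ↦ hasCardinalLT_of_hasCardinalLT_arrow (hJ' k))
  have hR : HasCardinalLT S.R μ := by
    rw [hasCardinalLT_sum_iff _ _ _ hμ]
    exact ⟨hasCardinalLT_sigma _ _ (hasCardinalLT_of_hasCardinalLT_arrow hK) hJ',
      hasCardinalLT_sigma _ _ hK (fun u ↦ hasCardinalLT_of_hasCardinalLT_arrow (hJ' _))⟩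
  obtain ⟨X, p, hX, hp, hp'⟩ := hy.exists_multiequalizer hκμ hC I hL hR
  have hpJ (k : K) {i j : J k} (f : i ⟶ j) : p ⟨k, i⟩ ≫ y.map ((G k).map f) = p ⟨k, j⟩ :=
    (hp (Sum.inl ⟨k, Arrow.mk f⟩)).trans
      ((congr_arg (p _ ≫ ·) (y.map_id _)).trans (Category.comp_id _))
  have hpK (u : Arrow K) (j : J u.right) :
      p ⟨u.left, j' u j⟩ ≫ y.map (g u j) = p ⟨u.right, j⟩ :=
    (hp (Sum.inr ⟨u, j⟩)).trans
      ((congr_arg (p _ ≫ ·) (y.map_id _)).trans (Category.comp_id _))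
  let s (k : K) : Cone (G k ⋙ y) :=
    { pt := X
      π :=
        { app j := p ⟨k, j⟩
          naturality i j f := (Category.id_comp _).trans (hpJ k f).symm } }
  have hs (k : K) (j : J k) : (hπ k).lift (s k) ≫ ρ k j = p ⟨k, j⟩ := (hπ k).fac (s k) j
  let c : Cone F :=
    { pt := X
      π :=
        { app k := (hπ k).lift (s k)
          naturality k k' u := by
            refine (Category.id_comp _).trans ((hπ k').hom_ext (fun j ↦ ?_))
            refine (hs k' j).trans ((hpK (Arrow.mk u) j).symm.trans ?_)
            refine (congr_arg (· ≫ _) (hs k _).symm).trans ((Category.assoc _ _ _).trans ?_)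
            exact (congr_arg (_ ≫ ·) (hg (Arrow.mk u) j)).trans (Category.assoc _ _ _).symm } }
  have hq (t : Cone F) (r : S.R) :
      (t.π.app (S.fst r).1 ≫ ρ _ (S.fst r).2) ≫ y.map (I.fst r) =
        (t.π.app (S.snd r).1 ≫ ρ _ (S.snd r).2) ≫ y.map (I.snd r) := by
    obtain (⟨k, f⟩ | ⟨u, j⟩) := r
    · change (t.π.app k ≫ ρ k f.left) ≫ y.map ((G k).map f.hom) =
        (t.π.app k ≫ ρ k f.right) ≫ y.map (𝟙 ((G k).obj f.right))
      rw [y.map_id, Category.comp_id, Category.assoc, hρ]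
    · change (t.π.app u.left ≫ ρ u.left (j' u j)) ≫ y.map (g u j) =
        (t.π.app u.right ≫ ρ u.right j) ≫ y.map (𝟙 ((G u.right).obj j))
      rw [y.map_id, Category.comp_id, Category.assoc, hg, ← Category.assoc, t.w]
  choose f hf hf' using fun t : Cone F ↦ hp' (fun l ↦ t.π.app l.1 ≫ ρ l.1 l.2) (hq t)
  refine ⟨c, ⟨{
    lift := f
    fac t k := (hπ k).hom_ext (fun j ↦ ?_)
    uniq t m hm := hf' t m (fun l ↦ ?_) }⟩, hX⟩
  · exact (Category.assoc _ _ _).trans ((congr_arg (f t ≫ ·) (hs k j)).trans (hf t ⟨k, j⟩))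
  · rw [← hm l.1, Category.assoc]
    exact congr_arg (m ≫ ·) (hs l.1 l.2).symm

section

variable (hκμ : SharplySmaller κ μ) (hC : IsLexCategory κ C) (hy : IsCopresentableEmbedding κ y)

include hκμ hC hy

lemma IsCopresentableEmbedding.hasLimit_preservesLimit_ι
    {K : Type w} [SmallCategory K] (hK : HasCardinalLT (Arrow K) μ)
    (F : K ⥤ (isCofilteredLimitOfEssImage κ μ y).FullSubcategory) :
    HasLimit F ∧ PreservesLimit F (isCofilteredLimitOfEssImage κ μ y).ι := by
  obtain ⟨c, ⟨hc⟩, hc'⟩ := hy.exists_isLimit hκμ hC hK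
    (F ⋙ (isCofilteredLimitOfEssImage κ μ y).ι) (fun k ↦ (F.obj k).property)
  have : HasLimit (F ⋙ (isCofilteredLimitOfEssImage κ μ y).ι) := ⟨⟨c, hc⟩⟩
  have := createsLimitFullSubcategoryInclusion' F hc hc'
  exact ⟨hasLimit_of_created F (isCofilteredLimitOfEssImage κ μ y).ι, inferInstance⟩

lemma IsCopresentableEmbedding.isLexCategory :
    IsLexCategory μ (isCofilteredLimitOfEssImage κ μ y).FullSubcategory :=
  fun _ _ hK ↦ ⟨fun F ↦ (hy.hasLimit_preservesLimit_ι hκμ hC hK F).1⟩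

lemma IsCopresentableEmbedding.isLexFunctor_ι :
    isLexFunctor μ _ _ (isCofilteredLimitOfEssImage κ μ y).ι :=
  fun _ _ hK ↦ ⟨fun {F} ↦ (hy.hasLimit_preservesLimit_ι hκμ hC hK F).2⟩

end

omit [Fact μ.IsRegular] in
lemma IsCopresentableEmbedding.isLexFunctor_lift (hy : IsCopresentableEmbedding κ y)
    (hP : ∀ c, isCofilteredLimitOfEssImage κ μ y (y.obj c)) :
    isLexFunctor κ _ _ ((isCofilteredLimitOfEssImage κ μ y).lift y hP) := by
  intro J _ hJ
  have := hy.isLex J hJ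
  have : PreservesLimitsOfShape J ((isCofilteredLimitOfEssImage κ μ y).lift y hP ⋙
      (isCofilteredLimitOfEssImage κ μ y).ι) := this
  exact preservesLimitsOfShape_of_reflects_of_preserves _ (isCofilteredLimitOfEssImage κ μ y).ι

end

/-! ### Right Kan extension along `φ`. -/

section

variable {κ μ : Cardinal.{w}} [Fact κ.IsRegular]
  {C : Type u₁} [Category.{v₁} C] {D : Type u₂} [Category.{v₂} D] {y : C ⥤ D}
  (hy : IsCopresentableEmbedding κ y)
  (hP : ∀ c, isCofilteredLimitOfEssImage κ μ y (y.obj c))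
  {E : Type u} [Category.{v} E]

include hy in
/-- A functor preserving `<μ`-limits on the category of `κ`-cofiltered `<μ`-limits of objects in
the image of `y` is the pointwise right Kan extension of its restriction. -/
lemma IsCopresentableEmbedding.nonempty_isPointwiseRightKanExtension
    {H : (isCofilteredLimitOfEssImage κ μ y).FullSubcategory ⥤ E} (hH : isLexFunctor μ _ _ H) :
    Nonempty (Functor.RightExtension.mk H
      (𝟙 ((isCofilteredLimitOfEssImage κ μ y).lift y hP ⋙ H))).IsPointwiseRightKanExtension := by
  have := hy.full
  have := hy.faithful
  refine ⟨fun X ↦ Nonempty.some ?_⟩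
  obtain ⟨J, _, hJ, hJ', G, π, ⟨hπ⟩⟩ := X.property.exists_presentation
  let φ := (isCofilteredLimitOfEssImage κ μ y).lift y hP
  let ρ (j : J) : X.obj ⟶ y.obj (G.obj j) := π.app j
  have hρ {i j : J} (f : i ⟶ j) : ρ i ≫ y.map (G.map f) = ρ j := (Cone.mk X.obj π).w f
  let T : J ⥤ StructuredArrow X φ :=
    { obj j := StructuredArrow.mk (Y := G.obj j) (S := X) (T := φ) (ObjectProperty.homMk (ρ j))
      map f := StructuredArrow.homMk (G.map f) (ObjectProperty.hom_ext _ (hρ f)) }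
  let c : Cone (G ⋙ φ) :=
    { pt := X
      π :=
        { app j := (T.obj j).hom
          naturality i j f := (Category.id_comp _).trans (StructuredArrow.w (T.map f)).symm } }
  have hc : IsLimit c := isLimitOfReflects (isCofilteredLimitOfEssImage κ μ y).ι hπ
  have : IsFiltered Jᵒᵖ := isFiltered_of_isCardinalFiltered _ κ
  have : IsCofiltered J := isCofiltered_of_isFiltered_op J
  -- Copresentability of `y d.right` says that every map from `X` to it factors through some stage,
  -- and that two such factorizations agree at a later stage. Hence the limit defining the Kan
  -- extension may be computed over `J`, where `H` preserves it.
  have : T.Initial := by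
    refine Functor.initial_of_exists_of_isCofiltered _ (fun d ↦ ?_) (fun {d j} s s' ↦ ?_)
    · have := hy.preservesColimitsOfShape d.right J hJ
      obtain ⟨j, g, hg⟩ := exists_hom_of_preservesColimit_yoneda hπ
        (X := y.obj d.right) d.hom.hom
      obtain ⟨g, rfl⟩ := y.map_surjective g
      exact ⟨j, ⟨StructuredArrow.homMk g (ObjectProperty.hom_ext _ hg)⟩⟩
    · have := hy.preservesColimitsOfShape d.right J hJ
      obtain ⟨i, a, ha⟩ := exists_eq_of_preservesColimit_yoneda_self hπ
        (X := y.obj d.right) (i := j) (y.map s.right) (y.map s'.right)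
        (congr_arg InducedCategory.Hom.hom
          ((StructuredArrow.w s).trans (StructuredArrow.w s').symm))
      exact ⟨i, a, StructuredArrow.hom_ext _ _ (y.map_injective
        ((y.map_comp _ _).trans (ha.trans (y.map_comp _ _).symm)))⟩
  have := hH J hJ'
  exact ⟨Functor.Initial.isLimitWhiskerEquiv T _ (IsLimit.ofIsoLimit (isLimitOfPreserves H hc)
    (Cone.ext (Iso.refl _) (fun _ ↦
      ((Category.id_comp _).trans (Category.comp_id _)).symm)))⟩


/-- The functors `E(e, -)` jointly reflect limits, and lifting universes reflects them too; the lift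
allows comparison with hom-sets of another category. -/
lemma preservesLimitsOfShape_of_coyoneda_ulift {J : Type u₃} [Category.{v₃} J]
    {D : Type u₁} [Category.{v₁} D] (H : D ⥤ E)
    (h : ∀ e : E, PreservesLimitsOfShape J (H ⋙ coyoneda.obj (op e) ⋙ uliftFunctor.{v₂})) :
    PreservesLimitsOfShape J H where
  preservesLimit {F} :=
    { preserves {c} hc := ⟨coyonedaJointlyReflectsLimits _ _ (fun e ↦ by
        have := h e.unop
        exact isLimitOfReflects uliftFunctor.{v₂} (isLimitOfPreserves
          (H ⋙ coyoneda.obj (op e.unop) ⋙ uliftFunctor.{v₂}) hc))⟩ }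

include hy in
-- Pointwise extensions are preserved by `E(e, -)`, so `E(e, H -)` extends `E(e, G -) ≅ D(Z, y -)`.
-- The restriction of `D(Z, -)` to `C̃` is μ-lex, hence extends the same functor, and uniqueness of
-- Kan extensions identifies the two.
lemma IsCopresentableEmbedding.isLexFunctor_of_isPointwiseRightKanExtension [Fact μ.IsRegular]
    (hκμ : SharplySmaller κ μ) (hC : IsLexCategory κ C)
    {H : (isCofilteredLimitOfEssImage κ μ y).FullSubcategory ⥤ E} {G : C ⥤ E}
    (α : (isCofilteredLimitOfEssImage κ μ y).lift y hP ⋙ H ⟶ G)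
    (hα : (Functor.RightExtension.mk H α).IsPointwiseRightKanExtension)
    (hG : ∀ e : E, ∃ Z : D, Nonempty (y ⋙ coyoneda.obj (op Z) ⋙ uliftFunctor.{v} ≅
      G ⋙ coyoneda.obj (op e) ⋙ uliftFunctor.{v₂})) :
    isLexFunctor μ _ _ H := by
  let φ := (isCofilteredLimitOfEssImage κ μ y).lift y hP
  intro J _ hJ
  suffices ∀ e : E, PreservesLimitsOfShape J (H ⋙ coyoneda.obj (op e) ⋙ uliftFunctor.{v₂}) from
    preservesLimitsOfShape_of_coyoneda_ulift H this
  intro e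
  obtain ⟨Z, ⟨i⟩⟩ := hG e
  let A := (isCofilteredLimitOfEssImage κ μ y).ι ⋙ coyoneda.obj (op Z) ⋙ uliftFunctor.{v}
  have hA : isLexFunctor μ _ _ A := fun K _ hK ↦ by
    have := hy.isLexFunctor_ι hκμ hC K hK
    infer_instance
  obtain ⟨hA'⟩ := hy.nonempty_isPointwiseRightKanExtension hP hA
  have : A.IsRightKanExtension (𝟙 (φ ⋙ A)) := hA'.isRightKanExtension
  let B := coyoneda.obj (op e) ⋙ uliftFunctor.{v₂}
  let β : φ ⋙ H ⋙ B ⟶ G ⋙ B := Functor.whiskerRight α B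
  have hβ : (Functor.RightExtension.mk (H ⋙ B) β).IsPointwiseRightKanExtension := fun X ↦
    IsLimit.ofIsoLimit (isLimitOfPreserves B (hα X)) (Cone.ext (Iso.refl _) (fun _ ↦
      (B.map_comp _ _).trans (Category.id_comp _).symm))
  have : (H ⋙ B).IsRightKanExtension β := hβ.isRightKanExtension
  have := hA J hJ
  exact preservesLimitsOfShape_of_natIso
    (Functor.rightKanExtensionUniqueOfIso A (𝟙 (φ ⋙ A)) i (H ⋙ B) β)

end

/-! ### The equivalence for an abstract copresentable embedding. -/

section

variable {κ μ : Cardinal.{w}} [Fact κ.IsRegular] [Fact μ.IsRegular]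
  {C : Type w} [SmallCategory C] {D : Type u₂} [Category.{w} D] {y : C ⥤ D}

lemma IsCopresentableEmbedding.isEquivalence_lexPrecomp (hκμ : SharplySmaller κ μ)
    (hC : IsLexCategory κ C) (hy : IsCopresentableEmbedding κ y)
    (hP : ∀ c, isCofilteredLimitOfEssImage κ μ y (y.obj c))
    (hφ : isLexFunctor κ _ _ ((isCofilteredLimitOfEssImage κ μ y).lift y hP))
    (E : Type u) [Category.{v} E] [HasLimitsOfSize.{w, w} E]
    (hE : ∀ G : C ⥤ E, isLexFunctor κ C E G → ∀ e : E,
      ∃ Z : D, Nonempty (y ⋙ coyoneda.obj (op Z) ⋙ uliftFunctor.{v} ≅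
        G ⋙ coyoneda.obj (op e) ⋙ uliftFunctor.{w})) :
    (lexPrecomp hκμ.le ((isCofilteredLimitOfEssImage κ μ y).lift y hP) hφ E).IsEquivalence := by
  have := hy.full
  have := hy.faithful
  let φ := (isCofilteredLimitOfEssImage κ μ y).lift y hP
  have hK (H : LexFunctors μ (isCofilteredLimitOfEssImage κ μ y).FullSubcategory E) :
      H.obj.IsRightKanExtension (𝟙 (φ ⋙ H.obj)) :=
    (hy.nonempty_isPointwiseRightKanExtension hP H.property).some.isRightKanExtension
  refine { faithful := ⟨fun {H H'} f g h ↦ ?_⟩, full := ⟨fun {H H'} f ↦ ?_⟩, essSurj := ⟨fun G ↦ ?_⟩ }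
  · have := hK H'
    refine ObjectProperty.hom_ext _ (H'.obj.hom_ext_of_isRightKanExtension (𝟙 (φ ⋙ H'.obj)) _ _ ?_)
    exact congr_arg (· ≫ 𝟙 _) ((ObjectProperty.ι _).congr_map h)
  · have := hK H'
    refine ⟨ObjectProperty.homMk
      (H'.obj.liftOfIsRightKanExtension (𝟙 (φ ⋙ H'.obj)) H.obj f.hom), ObjectProperty.hom_ext _ ?_⟩
    exact (Category.comp_id _).symm.trans
      (H'.obj.liftOfIsRightKanExtension_fac (𝟙 (φ ⋙ H'.obj)) H.obj f.hom)
  -- The pointwise extension exists because `C` is small and the hom-sets of `D` lie in `Type w`, so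
  -- its indexing categories are small. Full faithfulness of `φ` makes the counit invertible.
  · let H := φ.pointwiseRightKanExtension G.obj
    let α := φ.pointwiseRightKanExtensionCounit G.obj
    have hα := φ.pointwiseRightKanExtensionIsPointwiseRightKanExtension G.obj
    have hφ₁ : φ.Full := inferInstanceAs (ObjectProperty.lift _ y hP).Full
    have hφ₂ : φ.Faithful := inferInstanceAs (ObjectProperty.lift _ y hP).Faithful
    have hα' : IsIso α := hα.isIso_hom
    exact ⟨⟨H, hy.isLexFunctor_of_isPointwiseRightKanExtension hP hκμ hC α hα (hE _ G.property)⟩,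
      ⟨ObjectProperty.isoMk _ (@asIso _ _ _ _ α hα')⟩⟩

end

/-! ### Verification for `lexYoneda`. -/

section

variable (κ : Cardinal.{w}) (C : Type w) [SmallCategory C]

/-- The Yoneda lemma for `κ`-lex functors. -/
def lexYonedaCompCoyonedaIso (M : LexFunctors κ C (Type w)) :
    lexYoneda κ C ⋙ coyoneda.obj (op (op M)) ≅ M.obj :=
  NatIso.ofComponents (fun c ↦ Equiv.toIso
    { toFun f := coyonedaEquiv (X := c) (F := M.obj) f.unop.hom
      invFun x := Quiver.Hom.op (X := ((lexYoneda κ C).obj c).unop) (Y := M)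
        (ObjectProperty.homMk ((coyonedaEquiv (X := c) (F := M.obj)).symm x))
      left_inv f := Quiver.Hom.unop_inj (ObjectProperty.hom_ext _
        ((coyonedaEquiv (X := c) (F := M.obj)).symm_apply_apply f.unop.hom))
      right_inv x := (coyonedaEquiv (X := c) (F := M.obj)).apply_symm_apply x })
    (fun {c c'} f ↦ by
      ext g
      exact (coyonedaEquiv_naturality (F := M.obj) g.unop.hom f).symm)

/-- The Yoneda lemma for `κ`-lex functors, as an isomorphism of functors of the `κ`-lex functor. -/
def yonedaLexYonedaIso (c : C) :
    yoneda.obj ((lexYoneda κ C).obj c) ≅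
      unopUnop _ ⋙ (isLexFunctor κ C (Type w)).ι ⋙ (evaluation C (Type w)).obj c :=
  NatIso.ofComponents (fun M ↦ (lexYonedaCompCoyonedaIso κ C M.unop.unop).app c)
    (fun f ↦ by
      ext g
      exact coyonedaEquiv_comp (X := c) g.unop.hom f.unop.unop.hom)

lemma isLexFunctor_lexYoneda : isLexFunctor κ C _ (lexYoneda κ C) := by
  intro J _ hJ
  refine preservesLimitsOfShape_of_coyoneda_ulift.{w} _ (fun M ↦ ?_)
  have := M.unop.property J hJ
  exact preservesLimitsOfShape_of_natIso
    (Functor.isoWhiskerRight (lexYonedaCompCoyonedaIso κ C M.unop).symm uliftFunctor.{w})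

/-- The embedding `lexYoneda` is fully faithful. -/
def fullyFaithfulLexYoneda : (lexYoneda κ C).FullyFaithful where
  preimage g := (Coyoneda.fullyFaithful.preimage g.unop.hom).unop
  map_preimage g := Quiver.Hom.unop_inj (ObjectProperty.hom_ext _
    (Coyoneda.fullyFaithful.map_preimage g.unop.hom))
  preimage_map f := Quiver.Hom.op_inj (Coyoneda.fullyFaithful.preimage_map f.op)

variable [Fact κ.IsRegular]

/-- This is the commutation of `<κ`-limits with κ-filtered colimits in sets. For a limit cone `c` in
`C`, preservation of `c` by `Z` is invertibility at `Z` of a map `τ` between functors that preserve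
κ-filtered colimits, so it passes from the diagram to its colimit. -/
instance isClosedUnderColimitsOfShape_isLexFunctor (J : Type w) [SmallCategory J]
    [IsCardinalFiltered J κ] :
    (isLexFunctor κ C (Type w)).IsClosedUnderColimitsOfShape J where
  colimitsOfShape_le := by
    rintro G ⟨p⟩ K _ hK
    refine ⟨fun {F} ↦ ⟨fun {c} hc ↦ ?_⟩⟩
    let Φ : K ⥤ (C ⥤ Type w) ⥤ Type w := F ⋙ evaluation C (Type w)
    have (k : K) : (Φ.obj k).IsCardinalAccessible κ :=
      inferInstanceAs (((evaluation C (Type w)).obj (F.obj k)).IsCardinalAccessible κ)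
    -- A `<κ`-limit of the κ-accessible functors `Z ↦ Z (F k)` is κ-accessible.
    have hΦ := Functor.isCardinalAccessible_of_isLimit _ (limit.isLimit Φ) κ hK
    have := (limit.cone Φ).pt.preservesColimitsOfShape_of_isCardinalAccessible κ J
    have : PreservesColimitsOfShape J (limit Φ) := this
    let τ : (evaluation C (Type w)).obj c.pt ⟶ limit Φ :=
      limit.lift Φ ((evaluation C (Type w)).mapCone c)
    have hτ (Z : C ⥤ Type w) : Nonempty (IsLimit (Z.mapCone c)) ↔ IsIso (τ.app Z) := by
      have h := isLimitOfPreserves ((evaluation _ (Type w)).obj Z) (limit.isLimit Φ)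
      have : τ.app Z = h.lift (Z.mapCone c) := h.hom_ext (fun k ↦ by
        let s : Cone (Φ ⋙ (evaluation _ _).obj Z) := Z.mapCone c
        refine Eq.trans ?_ (h.fac s k).symm
        exact congr_arg (fun f ↦ NatTrans.app f Z)
          (limit.lift_π ((evaluation C (Type w)).mapCone c) k))
      rw [this]
      exact h.nonempty_isLimit_iff_isIso_lift
    have (j : J) : IsIso ((Functor.whiskerLeft p.diag τ).app j) := by
      have := p.prop_diag_obj j K hK
      exact (hτ _).1 ⟨isLimitOfPreserves _ hc⟩
    have : IsIso (Functor.whiskerLeft p.diag τ) := NatIso.isIso_of_isIso_app _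
    exact (hτ G).2 (isIso_app_coconePt_of_preservesColimit p.diag τ p.cocone p.isColimit)

/-- κ-filtered colimits of κ-lex functors are computed pointwise, and homming into `y c` in the
opposite category is evaluation at `c`, which therefore preserves them. -/
lemma isCopresentableEmbedding_lexYoneda : IsCopresentableEmbedding κ (lexYoneda κ C) where
  full := (fullyFaithfulLexYoneda κ C).full
  faithful := (fullyFaithfulLexYoneda κ C).faithful
  isLex := isLexFunctor_lexYoneda κ C
  hasLimitsOfShape J _ _ := by
    have : HasColimitsOfShape Jᵒᵖ (LexFunctors κ C (Type w)) :=
      hasColimitsOfShape_of_closedUnderColimits _ _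
    exact hasLimitsOfShape_op_of_hasColimitsOfShape
  preservesColimitsOfShape c J _ _ := by
    have : PreservesColimitsOfShape Jᵒᵖ (unopUnop (LexFunctors κ C (Type w))) :=
      inferInstanceAs (PreservesColimitsOfShape _ (opOpEquivalence _).functor)
    exact preservesColimitsOfShape_of_natIso (yonedaLexYonedaIso κ C c).symm

end

/-- `Z` is the κ-lex functor `E(e, G -)`, shrunk to `Type w` by local smallness; the Yoneda lemma
does the rest. -/
lemma exists_coyoneda_iso_of_isLexFunctor (κ : Cardinal.{w}) (C : Type w) [SmallCategory C]
    {E : Type u} [Category.{v} E] [LocallySmall.{w} E] {G : C ⥤ E} (hG : isLexFunctor κ C E G)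
    (e : E) : ∃ Z : (LexFunctors κ C (Type w))ᵒᵖ,
      Nonempty (lexYoneda κ C ⋙ coyoneda.obj (op Z) ⋙ uliftFunctor.{v} ≅
        G ⋙ coyoneda.obj (op e) ⋙ uliftFunctor.{w}) := by
  let M : LexFunctors κ C (Type w) :=
    ⟨G ⋙ (ShrinkHoms.equivalence E).functor ⋙ coyoneda.obj (op (ShrinkHoms.toShrinkHoms e)),
      fun J _ hJ ↦ by have := hG J hJ; infer_instance⟩
  refine ⟨op M, ⟨Functor.isoWhiskerRight (lexYonedaCompCoyonedaIso κ C M) uliftFunctor.{v} ≪≫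
    NatIso.ofComponents (fun c ↦ Equiv.toIso
      (Equiv.ulift.trans ((equivShrink _).symm.trans Equiv.ulift.symm))) (fun {c c'} f ↦ ?_)⟩⟩
  ext ⟨x⟩
  have h (z : Shrink.{w} (e ⟶ G.obj c)) :
      (equivShrink _).symm (equivShrink (e ⟶ G.obj c')
        ((equivShrink _).symm z ≫ (equivShrink _).symm (equivShrink _ (G.map f)))) =
      (equivShrink _).symm z ≫ G.map f := by simp only [Equiv.symm_apply_apply]
  exact congr_arg ULift.up (h x)

theorem mainTheorem9 (κ μ : Cardinal.{w}) [Fact κ.IsRegular] [Fact μ.IsRegular]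
    (hκμ : SharplySmaller κ μ) (C : Type w) [SmallCategory C] (hC : IsLexCategory κ C) :
    IsLexCategory μ (LexCompletion κ C μ) ∧
    ∃ hφ : isLexFunctor κ C (LexCompletion κ C μ) (lexCompletionEmbedding κ C μ),
      ∀ (E : Type u) [Category.{v} E] [LocallySmall.{w} E] [HasLimitsOfSize.{w, w} E],
        (lexPrecomp hκμ.le (lexCompletionEmbedding κ C μ) hφ E).IsEquivalence := by
  have hy := isCopresentableEmbedding_lexYoneda κ C
  have hP := isCofilteredLimitOfRepresentables_lexYoneda κ C μ
  exact ⟨hy.isLexCategory hκμ hC, hy.isLexFunctor_lift hP, fun E _ _ _ ↦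
    hy.isEquivalence_lexPrecomp hκμ hC hP _ E
      (fun _ hG ↦ exists_coyoneda_iso_of_isLexFunctor κ C hG)⟩
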